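/- Let $d\ge 2$, let $\Lambda=\mathrm{Mat}_d^0(\mathbb Z)$ be the additive group of integer $d\times d$ matrices of trace zero, and let $A_d=\widehat\Lambda$ be its (compact) dual group, whose non-zero rational points are the non-trivial characters of $\Lambda$ of finite order. A sequence $(F_k)$ of finite subsets of $\Lambda$ is F\o lner if $|F_k\cap(F_k+g)|/|F_k|\to1$ for every $g\in\Lambda$, and $d^*(B)=\sup_{(F_k)}\limsup_k |B\cap F_k|/|F_k|$, the supremum being over all F\o lner sequences, is the upper Banach density. A $\Lambda$-system $(X,\eta,\sigma)$ is a compact metric space $X$ with a Borel probability measure $\eta$ and a measurable, $\eta$-preserving action $\sigma$ of $\Lambda$; it is ergodic if every invariant measurable set has measure $0$ or $1$. Together with a measurable set $\tilde B\subset X$ it is called a Furstenberg system of $B\subset\Lambda$ if $\eta(\tilde B)=d^*(B)$ and $d^*(B\cap(B+h))\ge\eta(\tilde B\cap\sigma_h\tilde B)$ for all $h\in\Lambda$. A spectral measure of $f\in L^2(X,\eta)$ is a finite Borel measure $\nu\ge 0$ on $A_d$ with $\langle f,T_hf\rangle=\int_{A_d}\chi(h)\,d\nu(\chi)$ for all $h\in\Lambda$,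 where $T_hf=f\circ\sigma_{-h}$. Let $n\ge1$, let $\tau:\Lambda\to\mathbb T^n=\mathbb R^n/\mathbb Z^n$ be a homomorphism with dense image, let $U_o\subset\mathbb T^n$ be an open set whose boundary has Haar measure zero, let $T\subset\Lambda$ satisfy $d^*(T)=1$, and put $B=\tau^{-1}(U_o)\cap T$. Let $X=\mathbb T^n$, let $\eta$ be its normalised Haar measure, and let $\sigma_h(x)=x+\tau(h)$. Then: 1. $(X,\eta,\sigma)$ is ergodic, and together with $U_o$ it is a Furstenberg system of $B$. 2. $d^*(B\cap(B+h))=\eta(U_o\cap\sigma_h U_o)$ for every $h\in\Lambda$. 3. The function $1_{U_o}$ has a spectral measure, and no spectral measure of $1_{U_o}$ has an atom at a non-zero rational point of $A_d$. 4. There is also an ergodic Furstenberg system $(X',\eta',\sigma')$, $\tilde B'$ of $B$ in which $\tilde B'$ is clopen, such that $1_{\tilde B'}$ has a spectral measure and no spectral measure of $1_{\tilde B'}$ has an atom at a non-zero rational point of $A_d$. -/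

import Mathlib

open MeasureTheory Filter Topology
open scoped Pointwise

/-! ### Densities in abelian groups -/

/-- A sequence of finite subsets of `G` is Følner if it is asymptotically translation invariant.
(The convergence of the ratio to `1` forces the sets to be eventually nonempty.) -/
def IsFolner {G : Type*} [AddCommGroup G] (F : ℕ → Set G) : Prop :=
  (∀ n, (F n).Finite) ∧
    ∀ g : G, Tendsto (fun n => ((F n ∩ (g +ᵥ F n)).ncard : ℝ) / ((F n).ncard : ℝ)) atTop (𝓝 1)

/-- Upper Banach density: the supremum, over all Følner sequences `F`, of the upper densities
along `F`. All ratios lie in `[0, 1]`. -/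
noncomputable def upperBanachDensity {G : Type*} [AddCommGroup G] (B : Set G) : ℝ :=
  sSup {δ : ℝ | ∃ F : ℕ → Set G, IsFolner F ∧
    δ = limsup (fun n => ((B ∩ F n).ncard : ℝ) / ((F n).ncard : ℝ)) atTop}

/-! ### The group of traceless integer matrices and its dual -/

/-- The group `Λ` of traceless integer `d × d` matrices. -/
abbrev TracelessInt (d : ℕ) : AddSubgroup (Matrix (Fin d) (Fin d) ℤ) :=
  (Matrix.traceAddMonoidHom (Fin d) ℤ).ker

/-- The dual of a discrete abelian group `G`: the compact group of characters `G → Circle`.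
For `G = Λ` this is the torus `A_d`; its zero is the trivial character `1`, and its rational points
are the characters of finite order. -/
noncomputable abbrev DiscreteDual (G : Type*) [AddCommGroup G] [TopologicalSpace G] [DiscreteTopology G] :
    Type _ :=
  PontryaginDual (Multiplicative G)

noncomputable instance {A : Type*} [Monoid A] [TopologicalSpace A] : MeasurableSpace (PontryaginDual A) :=
  borel _

instance {A : Type*} [Monoid A] [TopologicalSpace A] : BorelSpace (PontryaginDual A) :=
  ⟨rfl⟩

/-- The value `χ(h)` as a complex number. -/
noncomputable def DiscreteDual.eval {G : Type*} [AddCommGroup G] [TopologicalSpace G]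
    [DiscreteTopology G] (χ : DiscreteDual G) (h : G) : ℂ :=
  ((χ (Multiplicative.ofAdd h) : Circle) : ℂ)

/-- `ν` has no atoms at nontrivial characters of finite order (nonzero rational points). -/
def NoNonzeroRationalAtoms {G : Type*} [AddCommGroup G] [TopologicalSpace G] [DiscreteTopology G]
    (ν : Measure (DiscreteDual G)) : Prop :=
  ∀ χ : DiscreteDual G, χ ≠ 1 → IsOfFinOrder χ → ν {χ} = 0

/-! ### Measure preserving systems -/

/-- A `G`-measure-preserving system on a compact metric space `X`: a Borel probability measure
together with an action of `G` by measure preserving measurable maps. -/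
structure MPSystem (G : Type*) [AddCommGroup G] (X : Type*) [MetricSpace X] [CompactSpace X]
    [MeasurableSpace X] [BorelSpace X] where
  meas : Measure X
  isProbabilityMeasure : IsProbabilityMeasure meas
  act : G → X → X
  act_zero : ∀ x, act 0 x = x
  act_add : ∀ g h x, act (g + h) x = act g (act h x)
  measurePreserving : ∀ g, MeasurePreserving (act g) meas meas

namespace MPSystem

variable {G : Type*} [AddCommGroup G] {X : Type*} [MetricSpace X] [CompactSpace X]
  [MeasurableSpace X] [BorelSpace X]

/-- Every invariant measurable set has measure zero or one. -/
def IsErgodic (S : MPSystem G X) : Prop :=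
  ∀ A : Set X, MeasurableSet A → (∀ g, S.act g '' A = A) → S.meas A = 0 ∨ S.meas A = 1

/-- `S` with the measurable set `B'` satisfies the correspondence principle for `B ⊆ G`. -/
structure IsFurstenberg (S : MPSystem G X) (B' : Set X) (B : Set G) : Prop where
  measurableSet : MeasurableSet B'
  le_density : ∀ h : G,
    S.meas.real (B' ∩ S.act h '' B') ≤ upperBanachDensity (B ∩ (h +ᵥ B))
  measure_eq : S.meas.real B' = upperBanachDensity B

/-- The Koopman operators `(T_h f)(x) = f (σ_{-h} x)`; thus `T_h 1_A = 1_{σ_h A}`. -/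
def koopman (S : MPSystem G X) (h : G) (f : X → ℂ) : X → ℂ :=
  fun x => f (S.act (-h) x)

/-- `ν` is a spectral measure of `f`: a finite Borel measure on the dual of `G` with
`⟨f, T_h f⟩ = ∫ χ(h) dν(χ)` for all `h`. -/
def IsSpectralMeasure [TopologicalSpace G] [DiscreteTopology G] (S : MPSystem G X) (f : X → ℂ)
    (ν : Measure (DiscreteDual G)) : Prop :=
  IsFiniteMeasure ν ∧
    ∀ h : G, ∫ x, f x * (starRingEnd ℂ) (S.koopman h f x) ∂S.meas
      = ∫ χ : DiscreteDual G, χ.eval h ∂ν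

/-- The indicator function `1_A`, with complex values. -/
noncomputable def ind (A : Set X) : X → ℂ :=
  A.indicator fun _ => 1

end MPSystem

/-- The normalised Haar measure of the torus `ℝⁿ / ℤⁿ`, as a product measure. -/
noncomputable def torusHaar (n : ℕ) : Measure (UnitAddTorus (Fin n)) :=
  Measure.pi fun _ => (AddCircle.haarAddCircle : Measure UnitAddCircle)

instance (n : ℕ) : IsProbabilityMeasure (torusHaar n) := by
  unfold torusHaar; infer_instance

instance (n : ℕ) : Measure.IsAddHaarMeasure (torusHaar n) := by
  unfold torusHaar; infer_instance

/-- The rotation `σ_h x = x + τ h` of the torus `ℝⁿ / ℤⁿ` with its normalised Haar measure. -/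
noncomputable def torusRotation {G : Type*} [AddCommGroup G] {n : ℕ}
    (τ : G →+ UnitAddTorus (Fin n)) : MPSystem G (UnitAddTorus (Fin n)) where
  meas := torusHaar n
  isProbabilityMeasure := inferInstance
  act h x := x + τ h
  act_zero x := by simp
  act_add g h x := by rw [map_add, add_comm (τ g), add_assoc]
  measurePreserving g := measurePreserving_add_right (torusHaar n) (τ g)

/-- A set whose boundary is a null set. -/
def IsJordanMeasurable {X : Type*} [TopologicalSpace X] [MeasurableSpace X] (η : Measure X)
    (A : Set X) : Prop :=
  η (frontier A) = 0

/-! Everything rests on equidistribution of `τ` along every Følner sequence. Averages of a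
nontrivial character are controlled by the boundary of the averaging sets, so they vanish in the
limit. Density of trigonometric polynomials extends this to continuous functions, and a null
frontier extends it to sets. Thus `τ ⁻¹' V` has frequency `η V` along every Følner sequence. Along
one that makes `T` nearly full, removing the complements of `T` and `h + T` costs almost nothing.
This gives all densities and correlations of `B` exactly (`upperBanachDensity_preimage_inter`).

For the atoms, `η (U ∩ (U + t))` is a continuous function `f` of `t`, and the Fourier coefficients
of a spectral measure are `f ∘ τ`. By Wiener's lemma the mass at `χ` is the mean of `conj χ * (f ∘
τ)`. Approximating `f` by trigonometric polynomials shows that this mean is zero unless `χ = e_k ∘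
τ` for some `k`. Such a `χ` of finite order is trivial: `e_k ^ m = 1` on a dense set, hence
everywhere, and the torus is divisible. Existence is Parseval's identity: `∑ |a_k|² δ_{e_k ∘ τ}` is
a spectral measure, where `a_k` are the Fourier coefficients.

For the clopen version, points are coded by their itineraries through `U`. This is a factor map onto
a shift system, and `U` is the preimage of a clopen cylinder. Ergodicity, correlations and spectral
measures all pass to the factor. -/

/-! ### Averages over finite sets -/

/-- The average of `f` over a finite set (zero if the set is empty). -/
noncomputable def finsetAverage {G : Type*} (s : Finset G) (f : G → ℂ) : ℂ :=
  (∑ g ∈ s, f g) / (s.card : ℂ)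

section FinsetAverage

variable {G : Type*} (s : Finset G)

lemma finsetAverage_sub (f f' : G → ℂ) :
    finsetAverage s f - finsetAverage s f' = finsetAverage s (fun g => f g - f' g) := by
  simp [finsetAverage, Finset.sum_sub_distrib, sub_div]

lemma finsetAverage_add (f f' : G → ℂ) :
    finsetAverage s (fun g => f g + f' g) = finsetAverage s f + finsetAverage s f' := by
  simp [finsetAverage, Finset.sum_add_distrib, add_div]

lemma finsetAverage_const_mul (a : ℂ) (f : G → ℂ) :
    finsetAverage s (fun g => a * f g) = a * finsetAverage s f := by
  simp [finsetAverage, ← Finset.mul_sum, mul_div_assoc]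

lemma norm_finsetAverage_le {f : G → ℂ} {C : ℝ} (hC : 0 ≤ C) (hf : ∀ g, ‖f g‖ ≤ C) :
    ‖finsetAverage s f‖ ≤ C := by
  rw [finsetAverage, norm_div, Complex.norm_natCast]
  refine div_le_of_le_mul₀ (by positivity) hC ?_
  calc ‖∑ g ∈ s, f g‖ ≤ s.card • C := norm_sum_le_of_le _ (fun g _ => hf g) |>.trans (by simp)
    _ = C * s.card := by simp [mul_comm]

lemma finsetAverage_const {s : Finset G} (hs : s.Nonempty) (a : ℂ) :
    finsetAverage s (fun _ => a) = a := by
  have : (s.card : ℂ) ≠ 0 := by simpa using hs.ne_empty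
  simp [finsetAverage, mul_div_cancel_left₀ _ this]

end FinsetAverage

/-! ### Følner sequences -/

namespace IsFolner

variable {G : Type*} [AddCommGroup G] {F : ℕ → Set G}

/-- The terms of a Følner sequence as finsets. -/
noncomputable def finset (hF : IsFolner F) (k : ℕ) : Finset G :=
  (hF.1 k).toFinset

@[simp]
lemma coe_finset (hF : IsFolner F) (k : ℕ) : (hF.finset k : Set G) = F k := by
  simp [finset]

lemma ncard_eq (hF : IsFolner F) (k : ℕ) : (F k).ncard = (hF.finset k).card := by
  rw [← hF.coe_finset k, Set.ncard_coe_finset]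

/-- For an empty set the ratio is `0 / 0 = 0`, which stays away from the limit `1`. -/
lemma eventually_ncard_pos (hF : IsFolner F) : ∀ᶠ k in atTop, 0 < (F k).ncard := by
  filter_upwards [(hF.2 0).eventually (lt_mem_nhds (zero_lt_one : (0 : ℝ) < 1))] with k hk
  by_contra h
  simp [show (F k).ncard = 0 by omega] at hk

lemma eventually_finset_nonempty (hF : IsFolner F) :
    ∀ᶠ k in atTop, (hF.finset k).Nonempty := by
  filter_upwards [hF.eventually_ncard_pos] with k hk
  rw [ncard_eq hF] at hk
  exact Finset.card_pos.1 hk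

lemma tendsto_ncard_diff (hF : IsFolner F) (g : G) :
    Tendsto (fun k => ((F k \ (g +ᵥ F k)).ncard : ℝ) / ((F k).ncard : ℝ)) atTop (𝓝 0) := by
  have h := (hF.2 g).const_sub 1
  rw [sub_self] at h
  refine h.congr' ?_
  filter_upwards [hF.eventually_ncard_pos] with k hk
  have h1 := Set.ncard_inter_add_ncard_sdiff_eq_ncard (F k) (g +ᵥ F k) (hF.1 k)
  have hk' : ((F k).ncard : ℝ) ≠ 0 := by positivity
  rw [eq_div_iff hk', sub_mul, div_mul_cancel₀ _ hk', one_mul, ← h1]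
  push_cast
  ring

lemma ncard_vadd_diff (hF : IsFolner F) (g : G) (k : ℕ) :
    ((g +ᵥ F k) \ F k).ncard = (F k \ (g +ᵥ F k)).ncard := by
  have h1 := Set.ncard_inter_add_ncard_sdiff_eq_ncard (F k) (g +ᵥ F k) (hF.1 k)
  have h2 := Set.ncard_inter_add_ncard_sdiff_eq_ncard (g +ᵥ F k) (F k) (hF.1 k).vadd_set
  rw [Set.ncard_vadd_set, Set.inter_comm] at h2
  omega

/-- Averages of a nontrivial unitary character along a Følner sequence tend to zero. -/
lemma tendsto_finsetAverage_character (hF : IsFolner F) {c : G → ℂ}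
    (hadd : ∀ g h, c (g + h) = c g * c h) (hnorm : ∀ g, ‖c g‖ = 1) {g : G} (hg : c g ≠ 1) :
    Tendsto (fun k => finsetAverage (hF.finset k) c) atTop (𝓝 0) := by
  classical
  have key : ∀ k, ‖finsetAverage (hF.finset k) c‖ ≤
      2 * (((F k \ (g +ᵥ F k)).ncard : ℝ) / ((F k).ncard : ℝ)) / ‖1 - c g‖ := by
    intro k
    have hpos : 0 < ‖1 - c g‖ := norm_pos_iff.2 (sub_ne_zero.2 hg.symm)
    set s := hF.finset k with hs
    have hvs : ((g +ᵥ s : Finset G) : Set G) = g +ᵥ F k := by simp [hs]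
    have hshift : ∑ x ∈ g +ᵥ s, c x = c g * ∑ x ∈ s, c x := by
      rw [Finset.mul_sum, ← Finset.image_vadd, Finset.sum_image]
      · simp [hadd]
      · intro a _ b _ hab
        simpa using hab
    -- Multiplying the sum by `1 - c g` subtracts its translate by `g`. Only the two boundary pieces
    -- survive, and they have equal size.
    have hdiff : ∑ x ∈ s, c x - ∑ x ∈ g +ᵥ s, c x
        = ∑ x ∈ s \ (g +ᵥ s), c x - ∑ x ∈ (g +ᵥ s) \ s, c x := by
      rw [Finset.sum_sdiff_sub_sum_sdiff]
    have hbound : ∀ t : Finset G, ‖∑ x ∈ t, c x‖ ≤ t.card := fun t => by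
      simpa using norm_sum_le_of_le t (fun x _ => (hnorm x).le)
    have h1 : (s \ (g +ᵥ s)).card = (F k \ (g +ᵥ F k)).ncard := by
      rw [← Set.ncard_coe_finset, Finset.coe_sdiff, hvs, hs, coe_finset]
    have h2 : ((g +ᵥ s) \ s).card = (F k \ (g +ᵥ F k)).ncard := by
      rw [← Set.ncard_coe_finset, Finset.coe_sdiff, hvs, hs, coe_finset, ncard_vadd_diff hF]
    rw [le_div_iff₀ hpos, ← norm_mul, finsetAverage, div_mul_eq_mul_div, mul_sub, mul_one,
      mul_comm _ (c g), ← hshift, hdiff, norm_div, Complex.norm_natCast, ← mul_div_assoc,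
      ncard_eq hF]
    gcongr
    calc _ ≤ _ := norm_sub_le _ _
      _ ≤ _ := add_le_add (hbound _) (hbound _)
      _ = _ := by rw [h1, h2]; ring
  refine squeeze_zero_norm key ?_
  simpa using ((hF.tendsto_ncard_diff g).const_mul 2).div_const ‖1 - c g‖

end IsFolner

/-! ### Equidistribution in the torus -/

section Equidistribution

variable {G : Type*} {n : ℕ}

/-- Convergence of weighted averages can be tested on the Fourier monomials. -/
lemma tendsto_finsetAverage_of_mFourier (s : ℕ → Finset G) (w : G → ℂ) (hw : ∀ g, ‖w g‖ ≤ 1)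
    (p : G → UnitAddTorus (Fin n)) (ℓ : C(UnitAddTorus (Fin n), ℂ) →L[ℂ] ℂ)
    (h : ∀ m, Tendsto (fun k => finsetAverage (s k) fun g => w g * UnitAddTorus.mFourier m (p g))
      atTop (𝓝 (ℓ (UnitAddTorus.mFourier m))))
    (f : C(UnitAddTorus (Fin n), ℂ)) :
    Tendsto (fun k => finsetAverage (s k) fun g => w g * f (p g)) atTop (𝓝 (ℓ f)) := by
  -- The functions satisfying the claim form a subspace containing the monomials. Since `‖w‖ ≤ 1`
  -- and `ℓ` is bounded, it is also closed under uniform limits, which is the `ε` estimate below.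
  let V : Submodule ℂ C(UnitAddTorus (Fin n), ℂ) :=
    { carrier := {f | Tendsto (fun k => finsetAverage (s k) fun g => w g * f (p g)) atTop
        (𝓝 (ℓ f))}
      zero_mem' := by simp [finsetAverage]
      add_mem' := fun {a b} ha hb => by
        simpa [mul_add, finsetAverage_add] using ha.add hb
      smul_mem' := fun a b hb => by
        simpa [mul_left_comm, finsetAverage_const_mul] using hb.const_mul a }
  have hspan : Submodule.span ℂ (Set.range UnitAddTorus.mFourier) ≤ V :=
    Submodule.span_le.2 (by rintro _ ⟨m, rfl⟩; exact h m)
  have hf : f ∈ (Submodule.span ℂ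
      (Set.range (UnitAddTorus.mFourier (d := Fin n)))).topologicalClosure := by
    rw [UnitAddTorus.span_mFourier_closure_eq_top]; trivial
  rw [Metric.tendsto_atTop]
  intro ε hε
  have hℓ : 0 < 1 + ‖ℓ‖ := by positivity
  obtain ⟨f', hf', hd⟩ := Metric.mem_closure_iff.1 hf (ε / (2 * (1 + ‖ℓ‖))) (by positivity)
  obtain ⟨N, hN⟩ := Metric.tendsto_atTop.1 (hspan hf') (ε / 2) (by positivity)
  refine ⟨N, fun k hk => ?_⟩
  have h1 : dist (finsetAverage (s k) fun g => w g * f (p g))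
      (finsetAverage (s k) fun g => w g * f' (p g)) ≤ dist f f' := by
    rw [dist_eq_norm, finsetAverage_sub]
    refine norm_finsetAverage_le _ dist_nonneg fun g => ?_
    rw [← mul_sub, norm_mul]
    calc _ ≤ 1 * ‖f (p g) - f' (p g)‖ := by gcongr; exact hw g
      _ ≤ _ := by rw [one_mul, ← dist_eq_norm]; exact ContinuousMap.dist_apply_le_dist _
  have h2 : dist (ℓ f') (ℓ f) ≤ ‖ℓ‖ * dist f f' := by
    rw [dist_comm f, dist_eq_norm, dist_eq_norm, ← map_sub]
    exact ℓ.le_opNorm _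
  calc _ ≤ _ := dist_triangle4 _ _ _ _
    _ < dist f f' + ε / 2 + ‖ℓ‖ * dist f f' :=
      add_lt_add_of_lt_of_le (add_lt_add_of_le_of_lt h1 (hN k hk)) h2
    _ = (1 + ‖ℓ‖) * dist f f' + ε / 2 := by ring
    _ ≤ (1 + ‖ℓ‖) * (ε / (2 * (1 + ‖ℓ‖))) + ε / 2 := by gcongr
    _ = ε := by field_simp; norm_num

lemma mFourier_add_apply (m : Fin n → ℤ) (x y : UnitAddTorus (Fin n)) :
    UnitAddTorus.mFourier m (x + y) = UnitAddTorus.mFourier m x * UnitAddTorus.mFourier m y := by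
  simp [UnitAddTorus.mFourier, Finset.prod_mul_distrib, fourier_apply, smul_add,
    AddCircle.toCircle_add]

lemma norm_mFourier_apply (m : Fin n → ℤ) (x : UnitAddTorus (Fin n)) :
    ‖UnitAddTorus.mFourier m x‖ = 1 := by
  simp only [UnitAddTorus.mFourier, ContinuousMap.coe_mk, norm_prod, fourier_apply,
    Circle.norm_coe, Finset.prod_const_one]

variable [AddCommGroup G] {F : ℕ → Set G} {τ : G →+ UnitAddTorus (Fin n)}

/-- A homomorphism with dense image equidistributes along Følner sequences. -/
lemma IsFolner.tendsto_finsetAverage_continuousMap (hF : IsFolner F) (hτ : DenseRange τ)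
    (f : C(UnitAddTorus (Fin n), ℂ)) :
    Tendsto (fun k => finsetAverage (hF.finset k) fun g => f (τ g)) atTop
      (𝓝 (∫ x, f x ∂torusHaar n)) := by
  have hint : ∀ f : C(UnitAddTorus (Fin n), ℂ), Integrable f (torusHaar n) := fun f =>
    f.continuous.integrable_of_hasCompactSupport (HasCompactSupport.of_compactSpace _)
  let ℓ : C(UnitAddTorus (Fin n), ℂ) →L[ℂ] ℂ := LinearMap.mkContinuous
    { toFun := fun f => ∫ x, f x ∂torusHaar n
      map_add' := fun f f' => integral_add (hint f) (hint f')
      map_smul' := fun a f => integral_const_mul a _ } 1 fun f => by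
        simpa using norm_integral_le_of_norm_le_const (μ := torusHaar n)
          (Eventually.of_forall fun x => f.norm_coe_le_norm x)
  have hmain := tendsto_finsetAverage_of_mFourier hF.finset (fun _ => 1) (by simp) τ ℓ ?_ f
  · simpa using! hmain
  intro m
  simp only [one_mul]
  change Tendsto _ _ (𝓝 (∫ x, UnitAddTorus.mFourier m x ∂torusHaar n))
  -- A monomial trivial on the dense image is identically `1`. Any other one has zero integral by
  -- translation invariance, and zero mean because it restricts to a nontrivial character.
  by_cases hm : ∀ g, UnitAddTorus.mFourier m (τ g) = 1
  · have hm1 : (UnitAddTorus.mFourier m : UnitAddTorus (Fin n) → ℂ) = fun _ => 1 :=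
      hτ.equalizer (UnitAddTorus.mFourier m).continuous continuous_const (funext hm)
    simp only [hm1, integral_const, probReal_univ, one_smul]
    refine tendsto_const_nhds.congr' ?_
    filter_upwards [hF.eventually_finset_nonempty] with k hk
    rw [finsetAverage_const hk]
  · push Not at hm
    obtain ⟨g, hg⟩ := hm
    have h0 : ∫ x, UnitAddTorus.mFourier m x ∂torusHaar n = 0 := by
      have h := integral_add_right_eq_self (μ := torusHaar n) (UnitAddTorus.mFourier m) (τ g)
      simp only [mFourier_add_apply, integral_mul_const] at h
      by_contra hne
      exact hg (mul_left_cancel₀ hne (by rw [h, mul_one]))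
    rw [h0]
    refine hF.tendsto_finsetAverage_character (c := fun g => UnitAddTorus.mFourier m (τ g))
      (fun a b => ?_) (fun a => norm_mFourier_apply _ _) hg
    rw [map_add, mFourier_add_apply]

end Equidistribution

/-- Convergence of averages of continuous functions gives convergence of visit frequencies to sets
with null frontier. -/
lemma tendsto_ncard_preimage_div_of_tendsto_finsetAverage {G X : Type*} [TopologicalSpace X]
    [CompactSpace X] [MeasurableSpace X] [BorelSpace X] [HasOuterApproxClosed X] (η : Measure X)
    [IsProbabilityMeasure η] (p : G → X) (s : ℕ → Finset G)
    (hs : ∀ᶠ k in atTop, (s k).Nonempty)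
    (h : ∀ f : C(X, ℂ), Tendsto (fun k => finsetAverage (s k) fun g => f (p g)) atTop
      (𝓝 (∫ x, f x ∂η)))
    {V : Set X} (hVm : MeasurableSet V) (hV : η (frontier V) = 0) :
    Tendsto (fun k => ((p ⁻¹' V ∩ s k).ncard : ℝ) / ((s k).card : ℝ)) atTop (𝓝 (η.real V)) := by
  classical
  -- Dropping finitely many terms makes every empirical measure below a probability measure, so that
  -- the portmanteau theorem applies.
  wlog hne : ∀ k, (s k).Nonempty generalizing s
  · obtain ⟨N, hN⟩ := eventually_atTop.1 hs
    refine (tendsto_add_atTop_iff_nat N).1 ?_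
    exact this (fun k => s (k + N)) (Eventually.of_forall fun k => hN _ (by omega))
      (fun f => (tendsto_add_atTop_iff_nat N).2 (h f)) (fun k => hN _ (by omega))
  have hcard : ∀ k, (s k).card ≠ 0 := fun k => Finset.card_ne_zero.2 (hne k)
  let μ : ℕ → ProbabilityMeasure X := fun k =>
    ⟨((s k).card : ENNReal)⁻¹ • ∑ g ∈ s k, Measure.dirac (p g), ⟨by
      simp [ENNReal.inv_mul_cancel, hcard k]⟩⟩
  let η' : ProbabilityMeasure X := ⟨η, inferInstance⟩
  have hμ : Tendsto μ atTop (𝓝 η') := by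
    refine (ProbabilityMeasure.tendsto_iff_forall_integral_rclike_tendsto ℂ).2 fun f => ?_
    refine (h f.toContinuousMap).congr fun k => ?_
    simp only [μ, ProbabilityMeasure.coe_mk, integral_smul_measure]
    rw [integral_finsetSum_measure fun g _ => f.integrable _]
    simp only [finsetAverage]
    rw [Finset.sum_congr rfl fun g _ => integral_dirac' _ _
      f.continuous.stronglyMeasurable]
    simp [div_eq_inv_mul]
  have hlim := ProbabilityMeasure.tendsto_measure_of_null_frontier_of_tendsto' hμ hV
  have hlim' := (ENNReal.tendsto_toReal (measure_ne_top η V)).comp hlim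
  refine hlim'.congr fun k => ?_
  have hsum : ∑ g ∈ s k, Measure.dirac (p g) V = ((p ⁻¹' V ∩ s k).ncard : ENNReal) := by
    have hset : p ⁻¹' V ∩ s k = ((s k).filter (fun g => p g ∈ V) : Finset G) := by
      ext g; simp [and_comm]
    rw [hset, Set.ncard_coe_finset, Finset.card_filter, Nat.cast_sum]
    refine Finset.sum_congr rfl fun g _ => ?_
    rw [Measure.dirac_apply' _ hVm, Set.indicator_apply]
    split_ifs <;> simp
  simp only [Function.comp_apply, μ, ProbabilityMeasure.coe_mk, Measure.smul_apply,
    Measure.finsetSum_apply, hsum, smul_eq_mul]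
  rw [ENNReal.toReal_mul, ENNReal.toReal_inv, ENNReal.toReal_natCast, ENNReal.toReal_natCast,
    div_eq_inv_mul]

/-! ### Upper Banach density of return time sets -/

section Density

variable {G : Type*} [AddCommGroup G] {F : ℕ → Set G}

lemma ncard_inter_div_mem_Icc (hF : IsFolner F) (B : Set G) (k : ℕ) :
    ((B ∩ F k).ncard : ℝ) / ((F k).ncard : ℝ) ∈ Set.Icc (0 : ℝ) 1 := by
  refine ⟨by positivity, div_le_one_of_le₀ ?_ (by positivity)⟩
  exact_mod_cast Set.ncard_le_ncard Set.inter_subset_right (hF.1 k)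

lemma isBoundedUnder_ncard_inter_div (hF : IsFolner F) (B : Set G) :
    IsBoundedUnder (· ≤ ·) atTop
      (fun k => ((B ∩ F k).ncard : ℝ) / ((F k).ncard : ℝ)) :=
  isBoundedUnder_of ⟨1, fun k => (ncard_inter_div_mem_Icc hF B k).2⟩

lemma isCoboundedUnder_ncard_inter_div (hF : IsFolner F) (B : Set G) :
    IsCoboundedUnder (· ≤ ·) atTop
      (fun k => ((B ∩ F k).ncard : ℝ) / ((F k).ncard : ℝ)) :=
  (isBoundedUnder_of ⟨0, fun k => (ncard_inter_div_mem_Icc hF B k).1⟩ :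
    IsBoundedUnder (· ≥ ·) atTop _).isCoboundedUnder_le

lemma bddAbove_upperDensities (B : Set G) :
    BddAbove {δ : ℝ | ∃ F : ℕ → Set G, IsFolner F ∧
      δ = limsup (fun n => ((B ∩ F n).ncard : ℝ) / ((F n).ncard : ℝ)) atTop} := by
  refine ⟨1, ?_⟩
  rintro _ ⟨F, hF, rfl⟩
  exact limsup_le_of_le (isCoboundedUnder_ncard_inter_div hF B)
    (Eventually.of_forall fun k => (ncard_inter_div_mem_Icc hF B k).2)

lemma IsFolner.limsup_le_upperBanachDensity (hF : IsFolner F) (B : Set G) :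
    limsup (fun k => ((B ∩ F k).ncard : ℝ) / ((F k).ncard : ℝ)) atTop ≤ upperBanachDensity B :=
  le_csSup (bddAbove_upperDensities B) ⟨F, hF, rfl⟩

/-- If the density is positive, it is approximated along some Følner sequence. -/
lemma exists_isFolner_frequently_lt {B : Set G} {a : ℝ} (ha : 0 ≤ a)
    (h : a < upperBanachDensity B) :
    ∃ F : ℕ → Set G, IsFolner F ∧
      ∃ᶠ k in atTop, a < ((B ∩ F k).ncard : ℝ) / ((F k).ncard : ℝ) := by
  have hne : {δ : ℝ | ∃ F : ℕ → Set G, IsFolner F ∧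
      δ = limsup (fun n => ((B ∩ F n).ncard : ℝ) / ((F n).ncard : ℝ)) atTop}.Nonempty := by
    -- If there were no Følner sequence, the supremum would take the default value `0`, against `0 ≤
    -- a`.
    by_contra hemp
    rw [Set.not_nonempty_iff_eq_empty] at hemp
    rw [upperBanachDensity, hemp, Real.sSup_empty] at h
    linarith
  obtain ⟨_, ⟨F, hF, rfl⟩, hlt⟩ := exists_lt_of_lt_csSup hne h
  exact ⟨F, hF, frequently_lt_of_lt_limsup (isCoboundedUnder_ncard_inter_div hF B) hlt⟩

/-- A point of `F k` outside `h + T` lies either outside `h + F k` or in `h + (F k \ T)`. The latter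
set has as many points as `F k \ T`, whence the factor `2`. -/
lemma ncard_inter_le_of_shift (hF : IsFolner F) (P T : Set G) (h : G) (k : ℕ) :
    (P ∩ F k).ncard ≤ (P ∩ (T ∩ (h +ᵥ T)) ∩ F k).ncard + 2 * (F k \ T).ncard
      + (F k \ (h +ᵥ F k)).ncard := by
  have hfin := hF.1 k
  have hsub : P ∩ F k ⊆ ((P ∩ (T ∩ (h +ᵥ T)) ∩ F k) ∪ (F k \ T)) ∪
      ((F k \ (h +ᵥ F k)) ∪ (h +ᵥ (F k \ T))) := by
    rw [Set.vadd_set_sdiff]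
    intro x hx
    simp only [Set.mem_union, Set.mem_inter_iff, Set.mem_sdiff] at hx ⊢
    tauto
  have h1 := Set.ncard_le_ncard hsub (((hfin.inter_of_right _).union hfin.sdiff).union
    (hfin.sdiff.union hfin.sdiff.vadd_set))
  have h2 := Set.ncard_union_le ((P ∩ (T ∩ (h +ᵥ T)) ∩ F k) ∪ (F k \ T))
    ((F k \ (h +ᵥ F k)) ∪ (h +ᵥ (F k \ T)))
  have h3 := Set.ncard_union_le (P ∩ (T ∩ (h +ᵥ T)) ∩ F k) (F k \ T)
  have h4 := Set.ncard_union_le (F k \ (h +ᵥ F k)) (h +ᵥ (F k \ T))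
  rw [Set.ncard_vadd_set] at h4
  omega

variable {n : ℕ} {τ : G →+ UnitAddTorus (Fin n)}

/-- Visit frequencies along Følner sequences of sets with null frontier. -/
lemma IsFolner.tendsto_ncard_preimage_div (hF : IsFolner F) (hτ : DenseRange τ)
    {V : Set (UnitAddTorus (Fin n))} (hVm : MeasurableSet V)
    (hV : IsJordanMeasurable (torusHaar n) V) :
    Tendsto (fun k => ((τ ⁻¹' V ∩ F k).ncard : ℝ) / ((F k).ncard : ℝ)) atTop
      (𝓝 ((torusHaar n).real V)) := by
  have h := tendsto_ncard_preimage_div_of_tendsto_finsetAverage (torusHaar n) τ hF.finset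
    hF.eventually_finset_nonempty (hF.tendsto_finsetAverage_continuousMap hτ) hVm hV
  simpa only [IsFolner.coe_finset, ← IsFolner.ncard_eq] using h

/-- Intersecting a return time set with a set of density one and a translate of it does not change
the upper Banach density. -/
theorem upperBanachDensity_preimage_inter (hτ : DenseRange τ)
    {V : Set (UnitAddTorus (Fin n))} (hVm : MeasurableSet V)
    (hV : IsJordanMeasurable (torusHaar n) V) {T : Set G} (hT : upperBanachDensity T = 1) (h : G) :
    upperBanachDensity (τ ⁻¹' V ∩ (T ∩ (h +ᵥ T))) = (torusHaar n).real V := by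
  -- The upper bound holds along every Følner sequence; the lower bound needs only one along which
  -- `T` is frequently almost full.
  refine le_antisymm (Real.sSup_le ?_ measureReal_nonneg) (le_of_forall_pos_le_add fun ε hε => ?_)
  · rintro _ ⟨F, hF, rfl⟩
    rw [← (hF.tendsto_ncard_preimage_div hτ hVm hV).limsup_eq]
    refine limsup_le_limsup (Eventually.of_forall fun k => ?_)
      (isCoboundedUnder_ncard_inter_div hF _) (isBoundedUnder_ncard_inter_div hF _)
    refine div_le_div_of_nonneg_right ?_ (by positivity)
    exact_mod_cast Set.ncard_le_ncard (Set.inter_subset_inter_left _ Set.inter_subset_left)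
      ((hF.1 k).inter_of_right _)
  -- The error `4 * δ` is made of one `δ` from equidistribution, two from the complement of `T`, and
  -- one from the Følner boundary. The cap at `1` keeps `1 - δ` nonnegative.
  · set δ := min (ε / 4) 1 with hδ
    have hδ0 : 0 < δ := by positivity
    have hδε : 4 * δ ≤ ε := by linarith [min_le_left (ε / 4) 1]
    obtain ⟨F, hF, hfreq⟩ := exists_isFolner_frequently_lt (B := T) (a := 1 - δ)
      (by linarith [min_le_right (ε / 4) 1]) (by rw [hT]; linarith)
    refine le_trans ?_ (add_le_add_left (hF.limsup_le_upperBanachDensity _) ε)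
    rw [← sub_le_iff_le_add]
    refine le_limsup_of_frequently_le ?_ (isBoundedUnder_ncard_inter_div hF _)
    have e1 := (hF.tendsto_ncard_preimage_div hτ hVm hV).eventually
      (lt_mem_nhds (sub_lt_self _ hδ0))
    have e2 := (hF.tendsto_ncard_diff h).eventually (gt_mem_nhds hδ0)
    refine (hfreq.and_eventually (e1.and (e2.and hF.eventually_ncard_pos))).mono ?_
    rintro k ⟨h1, h2, h3, h4⟩
    have hc : (0 : ℝ) < (F k).ncard := by exact_mod_cast h4
    have hle : ((τ ⁻¹' V ∩ F k).ncard : ℝ) ≤ (τ ⁻¹' V ∩ (T ∩ (h +ᵥ T)) ∩ F k).ncard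
        + 2 * (F k \ T).ncard + (F k \ (h +ᵥ F k)).ncard := by
      exact_mod_cast ncard_inter_le_of_shift hF (τ ⁻¹' V) T h k
    have hsplit : ((T ∩ F k).ncard : ℝ) + (F k \ T).ncard = (F k).ncard := by
      rw [Set.inter_comm]
      exact_mod_cast Set.ncard_inter_add_ncard_sdiff_eq_ncard (F k) T (hF.1 k)
    rw [lt_div_iff₀ hc] at h1 h2
    rw [div_lt_iff₀ hc] at h3
    rw [le_div_iff₀ hc]
    nlinarith

end Density

/-! ### Sets in the torus and their correlations -/

section Correlation

variable {n : ℕ} {U : Set (UnitAddTorus (Fin n))}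

lemma isJordanMeasurable_add_image (hU : IsJordanMeasurable (torusHaar n) U)
    (t : UnitAddTorus (Fin n)) : IsJordanMeasurable (torusHaar n) ((· + t) '' U) := by
  have h : frontier ((· + t) '' U) = (· + t) '' frontier U :=
    ((Homeomorph.addRight t).image_frontier U).symm
  rw [IsJordanMeasurable, h, Set.image_add_right, measure_preimage_add_right]
  exact hU

lemma IsJordanMeasurable.inter {X : Type*} [TopologicalSpace X] [MeasurableSpace X] {η : Measure X}
    {A B : Set X} (hA : IsJordanMeasurable η A) (hB : IsJordanMeasurable η B) :
    IsJordanMeasurable η (A ∩ B) := by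
  refine measure_mono_null (frontier_inter_subset A B) (measure_union_null ?_ ?_)
  · exact measure_mono_null Set.inter_subset_left hA
  · exact measure_mono_null Set.inter_subset_right hB

/-- The correlation function `t ↦ η (U ∩ (U + t))` of a set with null frontier is continuous. -/
lemma continuous_correlation (hU : IsOpen U) (hUJ : IsJordanMeasurable (torusHaar n) U) :
    Continuous fun t => (torusHaar n).real (U ∩ (· + t) '' U) := by
  have hmeas : ∀ t, MeasurableSet ((· + t) '' U) := fun t => by
    rw [Set.image_add_right]
    exact (hU.preimage (continuous_add_const _)).measurableSet
  classical
  have heq : (fun t => (torusHaar n).real (U ∩ (· + t) '' U)) = fun t =>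
      ∫ x, U.indicator (fun _ => (1 : ℝ)) x * U.indicator (fun _ => (1 : ℝ)) (x + -t)
        ∂torusHaar n := by
    funext t
    rw [← integral_indicator_one (hU.measurableSet.inter (hmeas t))]
    congr 1
    funext x
    simp only [Set.indicator_apply, Set.mem_inter_iff, Set.image_add_right, Set.mem_preimage,
      Pi.one_apply]
    split_ifs <;> simp_all
  -- By dominated convergence it suffices that, for almost every `x`, the integrand is continuous at
  -- `t`. This holds when `x - t` avoids the null frontier, since the indicator is locally constant
  -- there.
  rw [heq, continuous_iff_continuousAt]
  intro t
  have hind : Measurable (U.indicator (fun _ => (1 : ℝ))) :=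
    measurable_const.indicator hU.measurableSet
  refine continuousAt_of_dominated (bound := fun _ => 1) (Eventually.of_forall fun s => ?_)
    (Eventually.of_forall fun s => Eventually.of_forall fun x => ?_) (integrable_const _) ?_
  · exact (hind.mul (hind.comp (measurable_add_const _))).aestronglyMeasurable
  · simp only [Set.indicator_apply]
    split_ifs <;> simp
  · have hnull : ∀ᵐ x ∂torusHaar n, x + -t ∉ frontier U := by
      have : torusHaar n ((· + -t) ⁻¹' frontier U) = 0 := by
        rw [measure_preimage_add_right]; exact hUJ
      simpa only [ae_iff, not_not] using! this
    filter_upwards [hnull] with x hx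
    refine continuousAt_const.mul ?_
    refine ContinuousAt.comp (f := fun s => x + -s) (g := U.indicator (fun _ => (1 : ℝ))) ?_
      (by fun_prop)
    rw [← Set.mem_compl_iff, compl_frontier_eq_union_interior] at hx
    rcases hx with hx | hx
    · refine continuousAt_const.congr (f := fun _ => (1 : ℝ)) ?_
      filter_upwards [mem_interior_iff_mem_nhds.1 hx] with y hy
      simp [hy]
    · refine continuousAt_const.congr (f := fun _ => (0 : ℝ)) ?_
      filter_upwards [mem_interior_iff_mem_nhds.1 hx] with y hy
      simp [show y ∉ U from hy]

end Correlation

/-! ### Correlations determine spectral measures -/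

namespace MPSystem

variable {G : Type*} [AddCommGroup G] {X : Type*} [MetricSpace X] [CompactSpace X]
  [MeasurableSpace X] [BorelSpace X]

lemma act_image_eq_preimage (S : MPSystem G X) (h : G) (A : Set X) :
    S.act h '' A = S.act (-h) ⁻¹' A := by
  have h1 : ∀ x, S.act (-h) (S.act h x) = x := fun x => by
    rw [← S.act_add, neg_add_cancel, S.act_zero]
  have h2 : ∀ x, S.act h (S.act (-h) x) = x := fun x => by
    rw [← S.act_add, add_neg_cancel, S.act_zero]
  exact congrFun (Set.image_eq_preimage_of_inverse h1 h2) A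

lemma measurableSet_act_image (S : MPSystem G X) (h : G) {A : Set X} (hA : MeasurableSet A) :
    MeasurableSet (S.act h '' A) := by
  rw [act_image_eq_preimage]
  exact (S.measurePreserving _).measurable hA

lemma integral_ind_mul_koopman (S : MPSystem G X) {A : Set X} (hA : MeasurableSet A) (h : G) :
    ∫ x, ind A x * (starRingEnd ℂ) (S.koopman h (ind A) x) ∂S.meas
      = (S.meas.real (A ∩ S.act h '' A) : ℂ) := by
  classical
  have := S.isProbabilityMeasure
  have heq : (fun x => ind A x * (starRingEnd ℂ) (S.koopman h (ind A) x)) =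
      (A ∩ S.act h '' A).indicator fun _ => (1 : ℂ) := by
    funext x
    simp only [ind, koopman, act_image_eq_preimage, Set.indicator_apply, Set.mem_inter_iff,
      Set.mem_preimage]
    split_ifs <;> simp_all
  rw [heq, integral_indicator (hA.inter (S.measurableSet_act_image h hA))]
  simp [Measure.real]

variable [TopologicalSpace G] [DiscreteTopology G]

/-- Being a spectral measure of an indicator depends only on the correlations of the set, so it can
be transferred between systems. -/
lemma isSpectralMeasure_ind_iff (S : MPSystem G X) {A : Set X} (hA : MeasurableSet A)
    {ν : Measure (DiscreteDual G)} :
    S.IsSpectralMeasure (ind A) ν ↔ IsFiniteMeasure ν ∧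
      ∀ h : G, (S.meas.real (A ∩ S.act h '' A) : ℂ) = ∫ χ : DiscreteDual G, χ.eval h ∂ν := by
  simp only [IsSpectralMeasure, S.integral_ind_mul_koopman hA]

end MPSystem

/-! ### Atoms of measures on the dual group -/

namespace DiscreteDual

variable {G : Type*} [AddCommGroup G] [TopologicalSpace G] [DiscreteTopology G]

@[simp]
lemma norm_eval (χ : DiscreteDual G) (h : G) : ‖χ.eval h‖ = 1 := by
  exact Circle.norm_coe _

lemma eval_add (χ : DiscreteDual G) (g h : G) : χ.eval (g + h) = χ.eval g * χ.eval h := by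
  simp [eval, ofAdd_add, map_mul]

lemma continuous_eval (h : G) : Continuous fun χ : DiscreteDual G => χ.eval h := by
  refine continuous_subtype_val.comp ?_
  exact ContinuousEvalConst.continuous_eval_const (F := Multiplicative G →ₜ* Circle) _

lemma ext_eval {χ ψ : DiscreteDual G} (h : ∀ g, χ.eval g = ψ.eval g) : χ = ψ :=
  PontryaginDual.ext fun a => Subtype.ext (h a.toAdd)

lemma eval_one (g : G) : (1 : DiscreteDual G).eval g = 1 := by
  simp [eval]

lemma eval_pow (χ : DiscreteDual G) (m : ℕ) (g : G) :
    (χ ^ m : DiscreteDual G).eval g = χ.eval g ^ m := by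
  induction m with
  | zero => simp [eval_one]
  | succ m ih =>
    rw [pow_succ, pow_succ, ← ih]
    rfl

lemma conj_eval_mul_self (χ : DiscreteDual G) (g : G) :
    (starRingEnd ℂ) (χ.eval g) * χ.eval g = 1 := by
  rw [← Complex.normSq_eq_conj_mul_self, Complex.normSq_eq_norm_sq]
  simp

/-- Wiener's lemma: the mass of a point is the limit of averages of the Fourier coefficients
against that character. -/
lemma tendsto_finsetAverage_conj_mul_integral {F : ℕ → Set G} (hF : IsFolner F)
    (ν : Measure (DiscreteDual G)) [IsFiniteMeasure ν] (χ : DiscreteDual G) :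
    Tendsto (fun k => finsetAverage (hF.finset k) fun g =>
      (starRingEnd ℂ) (χ.eval g) * ∫ ψ : DiscreteDual G, ψ.eval g ∂ν) atTop
      (𝓝 (ν.real {χ} : ℂ)) := by
  have hint : ∀ g : G, Integrable (fun ψ : DiscreteDual G => ψ.eval g) ν := fun g =>
    (integrable_const (1 : ℝ)).mono' (continuous_eval g).measurable.aestronglyMeasurable
      (by simp)
  have heq : ∀ k, finsetAverage (hF.finset k) (fun g =>
      (starRingEnd ℂ) (χ.eval g) * ∫ ψ : DiscreteDual G, ψ.eval g ∂ν) =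
      ∫ ψ : DiscreteDual G, finsetAverage (hF.finset k) (fun g =>
        (starRingEnd ℂ) (χ.eval g) * ψ.eval g) ∂ν := by
    intro k
    simp only [finsetAverage]
    rw [integral_div, integral_finsetSum _ fun g _ => (hint g).const_mul _]
    simp only [integral_const_mul]
  have hlim : (ν.real {χ} : ℂ) =
      ∫ ψ, ({χ} : Set (DiscreteDual G)).indicator (fun _ => (1 : ℂ)) ψ ∂ν := by
    rw [integral_indicator (measurableSet_singleton χ)]
    simp [Measure.real]
  simp only [heq]
  rw [hlim]
  -- The averages of `conj χ * ψ` are bounded by `1` and tend to the indicator of `ψ = χ`.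
  refine tendsto_integral_of_dominated_convergence (fun _ => 1) (fun k => ?_)
    (integrable_const _) (fun k => Eventually.of_forall fun ψ => ?_)
    (Eventually.of_forall fun ψ => ?_)
  · have : Continuous fun ψ : DiscreteDual G => finsetAverage (hF.finset k) (fun g =>
        (starRingEnd ℂ) (χ.eval g) * ψ.eval g) := by
      unfold finsetAverage
      exact (continuous_finsetSum _ fun g _ =>
        continuous_const.mul (continuous_eval g)).div_const _
    exact this.measurable.aestronglyMeasurable
  · exact norm_finsetAverage_le _ zero_le_one (by simp)
  · by_cases h : ψ = χ
    · subst h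
      simp only [conj_eval_mul_self, Set.indicator_of_mem (Set.mem_singleton ψ)]
      refine tendsto_const_nhds.congr' ?_
      filter_upwards [hF.eventually_finset_nonempty] with k hk
      rw [finsetAverage_const hk]
    · rw [Set.indicator_of_notMem (by simpa using h)]
      obtain ⟨g, hg⟩ : ∃ g, ψ.eval g ≠ χ.eval g := by
        by_contra! hall
        exact h (ext_eval hall)
      refine hF.tendsto_finsetAverage_character
        (c := fun g => (starRingEnd ℂ) (χ.eval g) * ψ.eval g) (g := g)
        (fun a b => ?_) (by simp) fun h1 => hg ?_
      · simp only [eval_add, map_mul]; ring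
      · have h2 := congrArg (fun z => χ.eval g * z) h1
        simp only [mul_one, ← mul_assoc] at h2
        rwa [mul_comm (χ.eval g), conj_eval_mul_self, one_mul] at h2

end DiscreteDual

/-! ### Ergodicity of torus rotations -/

/-- A measurable set invariant under a dense set of translations is null or conull. -/
lemma eventuallyConst_of_dense_add_invariant {K : Type*} [AddCommGroup K] [TopologicalSpace K]
    [IsTopologicalAddGroup K] [R1Space K] [MeasurableSpace K] [BorelSpace K] [MeasurableAdd₂ K]
    (μ : Measure K) [IsFiniteMeasure μ] [μ.InnerRegular] [μ.IsAddLeftInvariant] {A : Set K}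
    (hA : MeasurableSet A) {D : Set K} (hD : Dense D) (h : ∀ t ∈ D, (t + ·) ⁻¹' A = A) :
    EventuallyConst A (ae μ) :=
  aeconst_of_dense_setOfPred_preimage_vadd_eq (M := K) hA.nullMeasurableSet (hD.mono h)

lemma torusRotation_isErgodic {G : Type*} [AddCommGroup G] {n : ℕ}
    {τ : G →+ UnitAddTorus (Fin n)} (hτ : DenseRange τ) : (torusRotation τ).IsErgodic := by
  intro A hA hinv
  have hconst : EventuallyConst A (ae (torusHaar n)) := by
    refine eventuallyConst_of_dense_add_invariant (torusHaar n) hA hτ ?_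
    rintro _ ⟨g, rfl⟩
    have h := hinv (-g)
    rw [MPSystem.act_image_eq_preimage, neg_neg] at h
    simpa only [add_comm (τ g)] using! h
  rcases eventuallyConst_set'.1 hconst with h | h
  · exact Or.inl ((measure_congr h).trans measure_empty)
  · exact Or.inr ((measure_congr h).trans (measure_univ (μ := torusHaar n)))

/-! ### Rational atoms -/

lemma mFourier_nsmul_apply {n : ℕ} (k : Fin n → ℤ) (m : ℕ) (x : UnitAddTorus (Fin n)) :
    UnitAddTorus.mFourier k (m • x) = UnitAddTorus.mFourier k x ^ m := by
  induction m with
  | zero => simp [UnitAddTorus.mFourier]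
  | succ m ih => rw [succ_nsmul, mFourier_add_apply, ih, pow_succ]

lemma exists_nsmul_eq_unitAddTorus {n m : ℕ} (hm : m ≠ 0) (x : UnitAddTorus (Fin n)) :
    ∃ y : UnitAddTorus (Fin n), m • y = x := by
  have h : ∀ i, ∃ z : UnitAddCircle, m • z = x i := fun i => by
    obtain ⟨r, hr⟩ := QuotientAddGroup.mk_surjective (x i)
    refine ⟨((r / m : ℝ) : UnitAddCircle), ?_⟩
    rw [← hr, ← AddCircle.coe_nsmul, nsmul_eq_mul, mul_div_cancel₀ _ (by exact_mod_cast hm)]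
  choose y hy using h
  exact ⟨y, funext hy⟩

section Atoms

variable {G : Type*} [AddCommGroup G] [TopologicalSpace G] [DiscreteTopology G] {n : ℕ}
  {τ : G →+ UnitAddTorus (Fin n)}

/-- A Fourier monomial whose restriction to a dense subgroup is a character of finite order is
trivial. -/
lemma eq_one_of_mFourier_comp_eq_eval (hτ : DenseRange τ) {k : Fin n → ℤ} {χ : DiscreteDual G}
    (hχ : IsOfFinOrder χ) (h : ∀ g, UnitAddTorus.mFourier k (τ g) = χ.eval g) : χ = 1 := by
  obtain ⟨m, hm, hpow⟩ := isOfFinOrder_iff_pow_eq_one.1 hχ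
  -- The `m`-th power is `1` on the dense image, hence on the whole torus. Writing `τ g` as `m • y`
  -- then gives `e_k (τ g) = e_k y ^ m = 1`.
  have h1 : (fun x => UnitAddTorus.mFourier k x ^ m) = fun _ => (1 : ℂ) := by
    refine hτ.equalizer (by fun_prop) continuous_const (funext fun g => ?_)
    simp only [Function.comp_apply, h]
    rw [← DiscreteDual.eval_pow, hpow, DiscreteDual.eval_one]
  refine DiscreteDual.ext_eval fun g => ?_
  obtain ⟨y, hy⟩ := exists_nsmul_eq_unitAddTorus hm.ne' (τ g)
  rw [← h, ← hy, mFourier_nsmul_apply, congrFun h1 y, DiscreteDual.eval_one]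

/-- A measure whose Fourier coefficients extend continuously to the torus has no nonzero rational
atoms. -/
lemma noNonzeroRationalAtoms_of_continuous {F : ℕ → Set G} (hF : IsFolner F) (hτ : DenseRange τ)
    {ν : Measure (DiscreteDual G)} [IsFiniteMeasure ν] (f : C(UnitAddTorus (Fin n), ℂ))
    (h : ∀ g, f (τ g) = ∫ χ : DiscreteDual G, χ.eval g ∂ν) : NoNonzeroRationalAtoms ν := by
  intro χ hχ1 hχ
  have h1 := DiscreteDual.tendsto_finsetAverage_conj_mul_integral hF ν χ
  simp only [← h] at h1
  -- The limit functional is `0`: no monomial restricts to `χ`, so each weighted monomial is a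
  -- nontrivial character and has mean zero.
  have h2 := tendsto_finsetAverage_of_mFourier hF.finset (fun g => (starRingEnd ℂ) (χ.eval g))
    (by simp) τ 0 (fun k => ?_) f
  · have h3 := tendsto_nhds_unique h1 h2
    simp only [zero_apply, Complex.ofReal_eq_zero] at h3
    exact (measureReal_eq_zero_iff).1 h3
  · obtain ⟨g, hg⟩ : ∃ g, UnitAddTorus.mFourier k (τ g) ≠ χ.eval g := by
      by_contra! hall
      exact hχ1 (eq_one_of_mFourier_comp_eq_eval hτ hχ hall)
    refine hF.tendsto_finsetAverage_character
      (c := fun g => (starRingEnd ℂ) (χ.eval g) * UnitAddTorus.mFourier k (τ g)) (g := g)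
      (fun a b => ?_) (by simp [norm_mFourier_apply]) fun h3 => hg ?_
    · simp only [DiscreteDual.eval_add, map_mul, map_add, mFourier_add_apply]; ring
    · have h4 := congrArg (fun z => χ.eval g * z) h3
      simp only [mul_one, ← mul_assoc] at h4
      rwa [mul_comm (χ.eval g), DiscreteDual.conj_eval_mul_self, one_mul] at h4

/-! ### Existence of spectral measures for torus rotations -/

/-- The character `g ↦ e_k (τ g)`. -/
noncomputable def torusCharacter (τ : G →+ UnitAddTorus (Fin n)) (k : Fin n → ℤ) : DiscreteDual G :=
  ContinuousMonoidHom.mk (A := Multiplicative G) (B := Circle)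
    { toFun := fun a => ⟨UnitAddTorus.mFourier k (τ a.toAdd),
        mem_sphere_zero_iff_norm.2 (norm_mFourier_apply _ _)⟩
      map_one' := Subtype.ext (by simp [UnitAddTorus.mFourier])
      map_mul' := fun a b => Subtype.ext <| by
        simp only [toAdd_mul, map_add, mFourier_add_apply]
        rfl }
    continuous_of_discreteTopology

lemma torusCharacter_eval (τ : G →+ UnitAddTorus (Fin n)) (k : Fin n → ℤ) (g : G) :
    (torusCharacter τ k).eval g = UnitAddTorus.mFourier k (τ g) :=
  rfl

lemma mFourierCoeff_congr_ae {f f' : UnitAddTorus (Fin n) → ℂ} (h : f =ᵐ[torusHaar n] f')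
    (k : Fin n → ℤ) : UnitAddTorus.mFourierCoeff f k = UnitAddTorus.mFourierCoeff f' k :=
  integral_congr_ae (by filter_upwards [h] with x hx; simp [hx])

lemma mFourierCoeff_translate (f : UnitAddTorus (Fin n) → ℂ) (t : UnitAddTorus (Fin n))
    (k : Fin n → ℤ) :
    UnitAddTorus.mFourierCoeff (fun x => f (x - t)) k
      = (starRingEnd ℂ) (UnitAddTorus.mFourier k t) * UnitAddTorus.mFourierCoeff f k := by
  change ∫ x, UnitAddTorus.mFourier (-k) x • f (x - t) ∂torusHaar n
    = _ * ∫ x, UnitAddTorus.mFourier (-k) x • f x ∂torusHaar n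
  rw [← integral_const_mul, ← integral_add_right_eq_self _ t]
  congr 1
  funext x
  rw [mFourier_add_apply, add_sub_cancel_right, ← UnitAddTorus.mFourier_neg, smul_eq_mul,
    smul_eq_mul]
  ring

/-- Parseval's identity for square integrable functions on the torus. -/
lemma hasSum_conj_mFourierCoeff_mul {f g : UnitAddTorus (Fin n) → ℂ}
    (hf : MemLp f 2 (torusHaar n)) (hg : MemLp g 2 (torusHaar n)) :
    HasSum (fun k => (starRingEnd ℂ) (UnitAddTorus.mFourierCoeff f k) *
      UnitAddTorus.mFourierCoeff g k) (∫ x, (starRingEnd ℂ) (f x) * g x ∂torusHaar n) := by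
  have h1 : (fun k => (starRingEnd ℂ) (UnitAddTorus.mFourierCoeff f k) *
      UnitAddTorus.mFourierCoeff g k) = fun k =>
      (starRingEnd ℂ) (UnitAddTorus.mFourierCoeff (hf.toLp f) k) *
        UnitAddTorus.mFourierCoeff (hg.toLp g) k :=
    funext fun k => congrArg₂ (fun a b => (starRingEnd ℂ) a * b)
      (mFourierCoeff_congr_ae hf.coeFn_toLp.symm k) (mFourierCoeff_congr_ae hg.coeFn_toLp.symm k)
  have h2 : ∫ x, (starRingEnd ℂ) (f x) * g x ∂torusHaar n
      = ∫ x, (starRingEnd ℂ) (hf.toLp f x) * hg.toLp g x ∂torusHaar n := by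
    refine integral_congr_ae ?_
    filter_upwards [hf.coeFn_toLp, hg.coeFn_toLp] with x hx1 hx2
    rw [hx1, hx2]
  rw [h1, h2]
  exact UnitAddTorus.hasSum_prod_mFourierCoeff (hf.toLp f) (hg.toLp g)

/-- The `k`-th Fourier mode is an eigenfunction of the rotation, so it contributes a point mass
`|a_k|²` at its character. -/
lemma exists_isSpectralMeasure_torusRotation (τ : G →+ UnitAddTorus (Fin n))
    {f : UnitAddTorus (Fin n) → ℂ} (hf : MemLp f 2 (torusHaar n)) :
    ∃ ν : Measure (DiscreteDual G), (torusRotation τ).IsSpectralMeasure f ν := by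
  set a : (Fin n → ℤ) → ℂ := UnitAddTorus.mFourierCoeff f with ha
  have hsum : Summable fun k => ‖a k‖ ^ 2 := by
    simpa [ha, sq] using (hasSum_conj_mFourierCoeff_mul hf hf).summable.norm
  let ν : Measure (DiscreteDual G) :=
    Measure.sum fun k => ENNReal.ofReal (‖a k‖ ^ 2) • Measure.dirac (torusCharacter τ k)
  have hreal : ∀ k, (ENNReal.ofReal (‖a k‖ ^ 2)).toReal = ‖a k‖ ^ 2 := fun k =>
    ENNReal.toReal_ofReal (by positivity)
  refine ⟨ν, ⟨?_⟩, fun h => ?_⟩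
  · simp only [ν, Measure.sum_apply _ MeasurableSet.univ, Measure.smul_apply, measure_univ,
      smul_eq_mul, mul_one]
    exact hsum.tsum_ofReal_lt_top
  · have hν := hasSum_integral_sum_dirac (x := torusCharacter τ)
      (f := fun χ : DiscreteDual G => χ.eval h) (c := fun k => ENNReal.ofReal (‖a k‖ ^ 2))
      (fun k => ENNReal.ofReal_ne_top) (by simpa [hreal] using hsum)
    refine HasSum.unique ?_ hν
    have hmp := measurePreserving_sub_right (torusHaar n) (τ h)
    have hg : MemLp (fun x => f (x - τ h)) 2 (torusHaar n) := hf.comp_measurePreserving hmp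
    have hpars := hasSum_conj_mFourierCoeff_mul hg hf
    have hterm : ∀ k, (starRingEnd ℂ) (UnitAddTorus.mFourierCoeff (fun x => f (x - τ h)) k) *
        UnitAddTorus.mFourierCoeff f k
        = (ENNReal.ofReal (‖a k‖ ^ 2)).toReal • (torusCharacter τ k).eval h := fun k => by
      rw [mFourierCoeff_translate, hreal, torusCharacter_eval, ← ha, map_mul, Complex.conj_conj,
        mul_assoc, ← Complex.normSq_eq_conj_mul_self, Complex.normSq_eq_norm_sq,
        Complex.real_smul, mul_comm]
    simp only [hterm] at hpars
    have hint : ∫ x, f x * (starRingEnd ℂ) ((torusRotation τ).koopman h f x)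
        ∂(torusRotation τ).meas = ∫ x, (starRingEnd ℂ) (f (x - τ h)) * f x ∂torusHaar n := by
      simp only [MPSystem.koopman, torusRotation, map_neg, sub_eq_add_neg, mul_comm]
    rw [hint]
    exact hpars

end Atoms

/-! ### Factors -/

namespace MPSystem

variable {G : Type*} [AddCommGroup G] {X : Type*} [MetricSpace X] [CompactSpace X]
  [MeasurableSpace X] [BorelSpace X] {Y : Type*} [MetricSpace Y] [CompactSpace Y]
  [MeasurableSpace Y] [BorelSpace Y]

/-- A factor map between measure preserving systems. -/
structure IsFactorMap (S : MPSystem G X) (R : MPSystem G Y) (φ : X → Y) : Prop where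
  measurePreserving : MeasurePreserving φ S.meas R.meas
  map_act : ∀ g x, φ (S.act g x) = R.act g (φ x)

namespace IsFactorMap

variable {S : MPSystem G X} {R : MPSystem G Y} {φ : X → Y}

lemma preimage_act_image (hφ : IsFactorMap S R φ) (g : G) (A : Set Y) :
    φ ⁻¹' (R.act g '' A) = S.act g '' (φ ⁻¹' A) := by
  ext x
  simp [act_image_eq_preimage, hφ.map_act]

lemma isErgodic (hφ : IsFactorMap S R φ) (hS : S.IsErgodic) : R.IsErgodic := by
  intro A hA hinv
  rw [← hφ.measurePreserving.measure_preimage hA.nullMeasurableSet]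
  refine hS _ (hφ.measurePreserving.measurable hA) fun g => ?_
  rw [← hφ.preimage_act_image, hinv]

lemma measureReal_preimage (hφ : IsFactorMap S R φ) {A : Set Y} (hA : MeasurableSet A) :
    S.meas.real (φ ⁻¹' A) = R.meas.real A :=
  hφ.measurePreserving.measureReal_preimage hA.nullMeasurableSet

lemma correlation_eq (hφ : IsFactorMap S R φ) {A : Set Y} (hA : MeasurableSet A) (h : G) :
    S.meas.real (φ ⁻¹' A ∩ S.act h '' (φ ⁻¹' A)) = R.meas.real (A ∩ R.act h '' A) := by
  rw [← hφ.preimage_act_image, ← Set.preimage_inter,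
    hφ.measureReal_preimage (hA.inter (R.measurableSet_act_image h hA))]

lemma isFurstenberg (hφ : IsFactorMap S R φ) {A : Set Y} (hA : MeasurableSet A) {B : Set G}
    (hS : S.IsFurstenberg (φ ⁻¹' A) B) : R.IsFurstenberg A B where
  measurableSet := hA
  le_density h := by
    rw [← hφ.correlation_eq hA]
    exact hS.le_density h
  measure_eq := by
    rw [← hφ.measureReal_preimage hA]
    exact hS.measure_eq

lemma isSpectralMeasure_ind_iff [TopologicalSpace G] [DiscreteTopology G]
    (hφ : IsFactorMap S R φ) {A : Set Y} (hA : MeasurableSet A) {ν : Measure (DiscreteDual G)} :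
    R.IsSpectralMeasure (ind A) ν ↔ S.IsSpectralMeasure (ind (φ ⁻¹' A)) ν := by
  rw [R.isSpectralMeasure_ind_iff hA,
    S.isSpectralMeasure_ind_iff (hφ.measurePreserving.measurable hA)]
  simp only [hφ.correlation_eq hA]

end IsFactorMap

end MPSystem

/-! ### Symbolic factors -/

/-- The space of `0`-`1` configurations on `G`, with the product topology. -/
def SymbolSpace (G : Type*) : Type _ :=
  G → Bool

namespace SymbolSpace

variable {G : Type*}

instance : TopologicalSpace (SymbolSpace G) :=
  inferInstanceAs (TopologicalSpace (G → Bool))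

instance : CompactSpace (SymbolSpace G) :=
  inferInstanceAs (CompactSpace (G → Bool))

instance : MeasurableSpace (SymbolSpace G) :=
  inferInstanceAs (MeasurableSpace (G → Bool))

instance [Countable G] : BorelSpace (SymbolSpace G) :=
  inferInstanceAs (BorelSpace (G → Bool))

instance [Countable G] : TopologicalSpace.MetrizableSpace (SymbolSpace G) :=
  inferInstanceAs (TopologicalSpace.MetrizableSpace (G → Bool))

noncomputable instance [Countable G] : MetricSpace (SymbolSpace G) :=
  TopologicalSpace.metrizableSpaceMetric _

/-- The cylinder set of configurations with symbol `1` at the origin. -/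
def cylinder (G : Type*) [Zero G] : Set (SymbolSpace G) :=
  {ω | ω 0 = true}

/-- The shift action. -/
def shift [Add G] (g : G) (ω : SymbolSpace G) : SymbolSpace G :=
  fun h => ω (h + g)

lemma measurable_shift [Add G] (g : G) : Measurable (shift g) :=
  measurable_pi_lambda (X := fun _ : G => Bool) _ fun h =>
    measurable_pi_apply (X := fun _ : G => Bool) (h + g)

lemma isClopen_cylinder [Zero G] : IsClopen (cylinder G) :=
  (isClopen_discrete ({true} : Set Bool)).preimage
    (continuous_apply (A := fun _ : G => Bool) (0 : G))

end SymbolSpace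

namespace MPSystem

variable {G : Type*} [AddCommGroup G] {X : Type*} [MetricSpace X] [CompactSpace X]
  [MeasurableSpace X] [BorelSpace X]

open Classical in
/-- The itinerary of a point with respect to a set. -/
noncomputable def itinerary (S : MPSystem G X) (A : Set X) (x : X) : SymbolSpace G :=
  fun h => decide (S.act h x ∈ A)

lemma measurable_itinerary (S : MPSystem G X) {A : Set X} (hA : MeasurableSet A) :
    Measurable (S.itinerary A) := by
  classical
  refine measurable_pi_lambda (X := fun _ : G => Bool) _ fun h => ?_
  refine measurable_to_bool ?_
  have : (fun x => S.itinerary A x h) ⁻¹' {true} = S.act h ⁻¹' A := by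
    ext x; simp [itinerary]
  rw [this]
  exact (S.measurePreserving h).measurable hA

lemma itinerary_act (S : MPSystem G X) (A : Set X) (g : G) (x : X) :
    S.itinerary A (S.act g x) = SymbolSpace.shift g (S.itinerary A x) := by
  funext h
  simp [SymbolSpace.shift, itinerary, S.act_add]

lemma preimage_cylinder_itinerary (S : MPSystem G X) (A : Set X) :
    S.itinerary A ⁻¹' SymbolSpace.cylinder G = A := by
  ext x
  simp [SymbolSpace.cylinder, itinerary, S.act_zero]

/-- The shift on `0`-`1` configurations, with the distribution of the itineraries of a set. -/
noncomputable def symbolicFactor [Countable G] (S : MPSystem G X) {A : Set X}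
    (hA : MeasurableSet A) : MPSystem G (SymbolSpace G) where
  meas := S.meas.map (S.itinerary A)
  isProbabilityMeasure :=
    have := S.isProbabilityMeasure
    Measure.isProbabilityMeasure_map (S.measurable_itinerary hA).aemeasurable
  act := SymbolSpace.shift
  act_zero ω := funext fun k => congrArg ω (add_zero k)
  act_add g h ω := funext fun k => congrArg ω (by rw [add_assoc])
  measurePreserving g := by
    refine ⟨SymbolSpace.measurable_shift g, ?_⟩
    rw [Measure.map_map (SymbolSpace.measurable_shift g) (S.measurable_itinerary hA)]
    conv_rhs => rw [← (S.measurePreserving g).map_eq]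
    rw [Measure.map_map (S.measurable_itinerary hA) (S.measurePreserving g).measurable]
    congr 1
    funext x
    exact (S.itinerary_act A g x).symm

lemma isFactorMap_itinerary [Countable G] (S : MPSystem G X) {A : Set X} (hA : MeasurableSet A) :
    IsFactorMap S (S.symbolicFactor hA) (S.itinerary A) :=
  ⟨⟨S.measurable_itinerary hA, rfl⟩, S.itinerary_act A⟩

end MPSystem

/-! ### The main theorem -/

section Main

variable {G : Type*} [AddCommGroup G] {n : ℕ} {τ : G →+ UnitAddTorus (Fin n)}
  {U : Set (UnitAddTorus (Fin n))} {T : Set G}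

/-- Correlations of return time sets equal correlations in the torus rotation. -/
lemma upperBanachDensity_inter_vadd (hτ : DenseRange τ) (hU : IsOpen U)
    (hUJ : IsJordanMeasurable (torusHaar n) U) (hT : upperBanachDensity T = 1) (h : G) :
    upperBanachDensity ((τ ⁻¹' U ∩ T) ∩ (h +ᵥ (τ ⁻¹' U ∩ T))) =
      (torusRotation τ).meas.real (U ∩ (torusRotation τ).act h '' U) := by
  have hset : (τ ⁻¹' U ∩ T) ∩ (h +ᵥ (τ ⁻¹' U ∩ T)) =
      τ ⁻¹' (U ∩ (torusRotation τ).act h '' U) ∩ (T ∩ (h +ᵥ T)) := by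
    rw [MPSystem.act_image_eq_preimage]
    ext g
    simp only [Set.mem_inter_iff, Set.mem_preimage,
      Set.mem_vadd_set_iff_neg_vadd_mem, vadd_eq_add, torusRotation, map_add,
      add_comm (τ (-h))]
    tauto
  rw [hset]
  exact upperBanachDensity_preimage_inter hτ
    (hU.measurableSet.inter ((torusRotation τ).measurableSet_act_image h hU.measurableSet))
    (hUJ.inter (isJordanMeasurable_add_image hUJ (τ h))) hT h

lemma isFurstenberg_torusRotation (hτ : DenseRange τ) (hU : IsOpen U)
    (hUJ : IsJordanMeasurable (torusHaar n) U) (hT : upperBanachDensity T = 1) :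
    (torusRotation τ).IsFurstenberg U (τ ⁻¹' U ∩ T) where
  measurableSet := hU.measurableSet
  le_density h := (upperBanachDensity_inter_vadd hτ hU hUJ hT h).ge
  measure_eq := by
    have h := upperBanachDensity_preimage_inter hτ hU.measurableSet hUJ hT 0
    rw [zero_vadd, Set.inter_self] at h
    exact h.symm

variable [TopologicalSpace G] [DiscreteTopology G]

lemma noNonzeroRationalAtoms_torusRotation (hτ : DenseRange τ) (hU : IsOpen U)
    (hUJ : IsJordanMeasurable (torusHaar n) U) {F : ℕ → Set G} (hF : IsFolner F)
    {ν : Measure (DiscreteDual G)}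
    (hν : (torusRotation τ).IsSpectralMeasure (MPSystem.ind U) ν) : NoNonzeroRationalAtoms ν := by
  rw [MPSystem.isSpectralMeasure_ind_iff _ hU.measurableSet] at hν
  have := hν.1
  exact noNonzeroRationalAtoms_of_continuous hF hτ
    ⟨fun t => ((torusHaar n).real (U ∩ (· + t) '' U) : ℂ),
      Complex.continuous_ofReal.comp (continuous_correlation hU hUJ)⟩ hν.2

end Main

theorem mainTheorem8 (d : ℕ) (hd : 2 ≤ d) (n : ℕ) (hn : 1 ≤ n)
    (τ : TracelessInt d →+ UnitAddTorus (Fin n)) (hτ : DenseRange τ)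
    (U : Set (UnitAddTorus (Fin n))) (hU : IsOpen U) (hUJ : IsJordanMeasurable (torusHaar n) U)
    (T : Set (TracelessInt d)) (hT : upperBanachDensity T = 1)
    (B : Set (TracelessInt d)) (hB : B = τ ⁻¹' U ∩ T) :
    -- the torus rotation with the set `U` is an ergodic Furstenberg system of `B`
    ((torusRotation τ).IsErgodic ∧ (torusRotation τ).IsFurstenberg U B) ∧
    -- with equality of all correlations
    (∀ h : TracelessInt d, upperBanachDensity (B ∩ (h +ᵥ B)) =
      (torusRotation τ).meas.real (U ∩ (torusRotation τ).act h '' U)) ∧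
    -- the spectral measure of `1_U` exists and has no atoms at nonzero rational points
    (∃ ν : Measure (DiscreteDual (TracelessInt d)),
      (torusRotation τ).IsSpectralMeasure (MPSystem.ind U) ν) ∧
    (∀ ν : Measure (DiscreteDual (TracelessInt d)),
      (torusRotation τ).IsSpectralMeasure (MPSystem.ind U) ν → NoNonzeroRationalAtoms ν) ∧
    -- the same for some ergodic Furstenberg system of `B` whose distinguished set is clopen
    (∃ (X : Type) (_ : MetricSpace X) (_ : CompactSpace X) (_ : MeasurableSpace X)
      (_ : BorelSpace X) (S : MPSystem (TracelessInt d) X) (B' : Set X),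
      IsClopen B' ∧ S.IsErgodic ∧ S.IsFurstenberg B' B ∧
      (∃ ν : Measure (DiscreteDual (TracelessInt d)),
        S.IsSpectralMeasure (MPSystem.ind B') ν) ∧
      ∀ ν : Measure (DiscreteDual (TracelessInt d)),
        S.IsSpectralMeasure (MPSystem.ind B') ν → NoNonzeroRationalAtoms ν) := by
  subst hB
  obtain ⟨F, hF, -⟩ := exists_isFolner_frequently_lt (B := T) le_rfl (by rw [hT]; exact one_pos)
  have hFur := isFurstenberg_torusRotation hτ hU hUJ hT
  have hspec : ∃ ν : Measure (DiscreteDual (TracelessInt d)),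
      (torusRotation τ).IsSpectralMeasure (MPSystem.ind U) ν :=
    exists_isSpectralMeasure_torusRotation τ
      (memLp_indicator_const 2 hU.measurableSet 1 (Or.inr (measure_ne_top _ _)))
  have hatom : ∀ ν : Measure (DiscreteDual (TracelessInt d)),
      (torusRotation τ).IsSpectralMeasure (MPSystem.ind U) ν → NoNonzeroRationalAtoms ν :=
    fun ν hν => noNonzeroRationalAtoms_torusRotation hτ hU hUJ hF hν
  refine ⟨⟨torusRotation_isErgodic hτ, hFur⟩, upperBanachDensity_inter_vadd hτ hU hUJ hT, hspec,
    hatom, ?_⟩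
  have : Countable (Matrix (Fin d) (Fin d) ℤ) :=
    inferInstanceAs (Countable (Fin d → Fin d → ℤ))
  have hφ := (torusRotation τ).isFactorMap_itinerary hU.measurableSet
  have hcl := SymbolSpace.isClopen_cylinder (G := TracelessInt d)
  have hcyl := hcl.isOpen.measurableSet
  have hpre := (torusRotation τ).preimage_cylinder_itinerary U
  refine ⟨SymbolSpace (TracelessInt d), inferInstance, inferInstance, inferInstance, inferInstance,
    (torusRotation τ).symbolicFactor hU.measurableSet, SymbolSpace.cylinder _, hcl,
    hφ.isErgodic (torusRotation_isErgodic hτ), hφ.isFurstenberg hcyl (hpre.symm ▸ hFur), ?_⟩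
  simp only [hφ.isSpectralMeasure_ind_iff hcyl, hpre]
  exact ⟨hspec, hatom⟩
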